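/- Let $\rho,\sigma$ be quantum states (positive semidefinite operators of trace one) on a finite-dimensional complex Hilbert space. For $\gamma\ge 0$ let $E_\gamma(\rho\|\sigma)=\mathrm{Tr}(\rho-\gamma\sigma)_+$, where $\mathrm{Tr}(X)_+$ is the sum of the positive eigenvalues of the Hermitian operator $X$. For $f:(0,\infty)\to\mathbb R$ convex and twice differentiable with $f(1)=0$ let $$D_f(\rho\|\sigma)=\int_1^\infty\Big(f''(\gamma)E_\gamma(\rho\|\sigma)+\gamma^{-3}f''(\gamma^{-1})E_\gamma(\sigma\|\rho)\Big)\,d\gamma\in[0,\infty].$$ For $\alpha>1$ let $H_\alpha(\rho\|\sigma)=D_{f_\alpha}(\rho\|\sigma)$ with $f_\alpha(x)=\frac{x^\alpha-1}{\alpha-1}$, and $D_\alpha(\rho\|\sigma)=\frac1{\alpha-1}\log\big(1+(\alpha-1)H_\alpha(\rho\|\sigma)\big)$, where $\log$ is the natural logarithm and $\log\infty=\infty$. Then for every integer $\alpha\ge 2$ the number $\mathrm{Tr}\big[(\rho(\sigma+s\mathbb 1)^{-1})^\alpha\big]$ is real and non-negative for all $s>0$, and, in $(-\infty,\infty]$,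 $$H_\alpha(\rho\|\sigma)=\int_0^\infty \mathrm{Tr}\big[(\rho(\sigma+s\mathbb 1)^{-1})^\alpha\big]\,ds-\frac1{\alpha-1},$$ $$D_\alpha(\rho\|\sigma)=\frac1{\alpha-1}\log\Big((\alpha-1)\int_0^\infty \mathrm{Tr}\big[(\rho(\sigma+s\mathbb 1)^{-1})^\alpha\big]\,ds\Big).$$ If moreover the support of $\rho$ is contained in the support of $\sigma$, then the integral is finite, so that both identities hold between real numbers. -/

import Mathlib

open MeasureTheory Set
open scoped ComplexOrder ENNReal

noncomputable section

/-- A quantum state on the finite-dimensional Hilbert space `ℂⁿ`: a positive semidefinite complex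
matrix with unit trace. -/
structure QState (n : Type*) [Fintype n] where
  /-- the underlying matrix -/
  mat : Matrix n n ℂ
  posSemidef : mat.PosSemidef
  trace_eq_one : mat.trace = 1

namespace QState

variable {n : Type*} [Fintype n]

/-- `ρ - γ σ` is Hermitian for real `γ`. -/
theorem isHermitian_sub_smul (ρ σ : QState n) (γ : ℝ) :
    (ρ.mat - (γ : ℂ) • σ.mat).IsHermitian := by
  refine ρ.posSemidef.isHermitian.sub ?_
  unfold Matrix.IsHermitian
  rw [Matrix.conjTranspose_smul, σ.posSemidef.isHermitian.eq]
  simp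

/-- `ρ ≪ σ`: the support (range) of `ρ` is contained in the support (range) of `σ`. -/
def SuppLE (ρ σ : QState n) : Prop :=
  LinearMap.range ρ.mat.mulVecLin ≤ LinearMap.range σ.mat.mulVecLin

end QState

/-- `Tr (X)₊`, the sum of the positive eigenvalues (with multiplicity) of a Hermitian matrix. -/
def trPosPart {n : Type*} [Fintype n] [DecidableEq n] {X : Matrix n n ℂ}
    (hX : X.IsHermitian) : ℝ :=
  ∑ i, max (hX.eigenvalues i) 0

/-- The quantum hockey-stick divergence `E_γ(ρ‖σ) = Tr (ρ - γ σ)₊`. -/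
def hockeyStick {n : Type*} [Fintype n] [DecidableEq n] (γ : ℝ) (ρ σ : QState n) : ℝ :=
  trPosPart (ρ.isHermitian_sub_smul σ γ)

/-- The quantum `f`-divergence
`D_f(ρ‖σ) = ∫_1^∞ (f''(γ) E_γ(ρ‖σ) + γ⁻³ f''(γ⁻¹) E_γ(σ‖ρ)) dγ ∈ [0, ∞]`,
for `f` convex and twice differentiable on `(0, ∞)` with `f 1 = 0`.
Only the values of `f` on `(0, ∞)` matter, and the integrand is nonnegative for such `f`, so that
the integral always has a value in `[0, ∞]`. -/
def fDivergence {n : Type*} [Fintype n] [DecidableEq n] (f : ℝ → ℝ) (ρ σ : QState n) : ℝ≥0∞ :=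
  ∫⁻ γ in Ioi (1 : ℝ), ENNReal.ofReal
    (iteratedDeriv 2 f γ * hockeyStick γ ρ σ
      + (γ ^ 3)⁻¹ * iteratedDeriv 2 f γ⁻¹ * hockeyStick γ σ ρ)

/-- The function `f_α(x) = (x^α - 1) / (α - 1)`, for `α > 0`, `α ≠ 1`. -/
def hellingerFun (α : ℝ) (x : ℝ) : ℝ := (x ^ α - 1) / (α - 1)

/-- The quantum Hellinger divergence `H_α = D_{f_α}` of order `α > 0`, `α ≠ 1`. -/
def hellinger {n : Type*} [Fintype n] [DecidableEq n] (α : ℝ) (ρ σ : QState n) : ℝ≥0∞ :=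
  fDivergence (hellingerFun α) ρ σ

/-- The quantum Rényi divergence `D_α = (α - 1)⁻¹ log (1 + (α - 1) H_α)` of order `α > 0`,
`α ≠ 1`, in the extended reals, with `log 0 = -∞` and `log ∞ = ∞`. The argument of the logarithm
is nonnegative. -/
def renyi {n : Type*} [Fintype n] [DecidableEq n] (α : ℝ) (ρ σ : QState n) : EReal :=
  ((1 / (α - 1) : ℝ) : EReal) *
    ENNReal.log (1 + ((α - 1 : ℝ) : EReal) * ((hellinger α ρ σ : ℝ≥0∞) : EReal)).toENNReal

/-- `Tr[(ρ (σ + s 𝟙)⁻¹)^k]`; the inverse is a true inverse for `s > 0`. -/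
def resolventTrace {n : Type*} [Fintype n] [DecidableEq n] (k : ℕ) (ρ σ : QState n) (s : ℝ) : ℂ :=
  ((ρ.mat * (σ.mat + (s : ℂ) • (1 : Matrix n n ℂ))⁻¹) ^ k).trace

end

/-! Both sides are integrals of one counting function: let `N(γ, u)` be the number of positive
eigenvalues of `ρ - γ(σ + u)`, and write `k` for the integer order `α`.

For fixed `γ > 0`, `N(γ, u)` counts the eigenvalues of `ρ - γσ` above `γu`, so the layer-cake
formula gives `E_γ(ρ‖σ) = γ ∫ N(γ, u) du` (`ofReal_hockeyStick`). For fixed `u > 0`, Sylvester's law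
of inertia shows that `N(γ, u)` counts the eigenvalues above `γ` of `(σ + u)^{-1/2} ρ (σ +
u)^{-1/2}`. Hence `∫ k γ^{k-1} N(γ, u) dγ` is the sum of their `k`-th powers, which is the resolvent
trace (`lintegral_pencilCount`). Tonelli's theorem joins the two.

On the divergence side `f'' = k γ^{k-2}`. The substitution `γ ↦ 1/γ` and `E_u(ρ‖σ) = u E_{1/u}(σ‖ρ)
+ 1 - u` turn the reversed term into the missing integral over `(0, 1)`, less `∫₀¹ k u^{k-2}(1 - u)
du = 1/(k-1)`. -/

noncomputable section

/-! ### Inertia of Hermitian matrices -/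

namespace Matrix.IsHermitian

variable {n : Type*} [Fintype n] [DecidableEq n] {X Y : Matrix n n ℂ}

/-- The number of positive eigenvalues of a Hermitian matrix, with multiplicity. -/
def numPos (hX : X.IsHermitian) : ℕ := Fintype.card {i // 0 < hX.eigenvalues i}

theorem eq_unitary_mul_diagonal (hX : X.IsHermitian) :
    X = (hX.eigenvectorUnitary : Matrix n n ℂ) * diagonal (fun i ↦ (hX.eigenvalues i : ℂ)) *
      (hX.eigenvectorUnitary : Matrix n n ℂ)ᴴ := by
  have h := hX.spectral_theorem
  rw [Unitary.conjStarAlgAut_apply] at h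
  exact h

theorem conjTranspose_eigenvectorUnitary_mul (hX : X.IsHermitian) :
    (hX.eigenvectorUnitary : Matrix n n ℂ)ᴴ * (hX.eigenvectorUnitary : Matrix n n ℂ) = 1 :=
  Unitary.coe_star_mul_self _

theorem eigenvectorUnitary_mul_conjTranspose (hX : X.IsHermitian) :
    (hX.eigenvectorUnitary : Matrix n n ℂ) * (hX.eigenvectorUnitary : Matrix n n ℂ)ᴴ = 1 :=
  Unitary.coe_mul_star_self _

/-- Similar matrices share a characteristic polynomial, so the two multisets of roots agree. Sums
over a test function `g` avoid matching indices. -/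
theorem sum_eigenvalues_eq_of_unitary {M : Type*} [AddCommMonoid M] (hY : Y.IsHermitian)
    {U : Matrix n n ℂ} (hU : Uᴴ * U = 1) {d : n → ℝ}
    (h : Y = U * diagonal (fun i ↦ (d i : ℂ)) * Uᴴ) (g : ℝ → M) :
    ∑ i, g (hY.eigenvalues i) = ∑ i, g (d i) := by
  have h1 : Y.charpoly = (diagonal (fun i ↦ (d i : ℂ))).charpoly := by
    rw [h, charpoly_mul_comm, ← mul_assoc, hU, one_mul]
  have h2 := hY.roots_charpoly_eq_eigenvalues
  have h3 := Polynomial.roots_multiset_prod_X_sub_C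
    (Finset.univ.val.map fun i ↦ (d i : ℂ))
  rw [Multiset.map_map] at h3
  rw [h1, charpoly_diagonal] at h2
  have h4 := congrArg (fun m ↦ (m.map fun z : ℂ ↦ g z.re).sum) (h2.symm.trans h3)
  simp only [Multiset.map_map] at h4
  exact h4

/-- The eigenvalues of `a X + b` are those of `X` transformed by `x ↦ a x + b`. -/
theorem sum_eigenvalues_affine {M : Type*} [AddCommMonoid M] (hX : X.IsHermitian) (a b : ℝ)
    (hY : Y.IsHermitian) (h : Y = (a : ℂ) • X + (b : ℂ) • (1 : Matrix n n ℂ)) (g : ℝ → M) :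
    ∑ i, g (hY.eigenvalues i) = ∑ i, g (a * hX.eigenvalues i + b) := by
  refine sum_eigenvalues_eq_of_unitary hY hX.conjTranspose_eigenvectorUnitary_mul ?_ g
  have h1 : diagonal (fun i ↦ ((a * hX.eigenvalues i + b : ℝ) : ℂ)) =
      (a : ℂ) • diagonal (fun i ↦ (hX.eigenvalues i : ℂ)) + (b : ℂ) • (1 : Matrix n n ℂ) := by
    ext i j
    by_cases hij : i = j <;> simp [hij, diagonal]
  rw [h1, mul_add, add_mul, Matrix.mul_smul, Matrix.smul_mul, Matrix.mul_smul, Matrix.smul_mul,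
    mul_one, hX.eigenvectorUnitary_mul_conjTranspose, ← hX.eq_unitary_mul_diagonal, h]

theorem numPos_affine (hX : X.IsHermitian) (a b : ℝ)
    (hY : Y.IsHermitian) (h : Y = (a : ℂ) • X + (b : ℂ) • (1 : Matrix n n ℂ)) :
    hY.numPos = Fintype.card {i // 0 < a * hX.eigenvalues i + b} := by
  have := sum_eigenvalues_affine hX a b hY h (fun x ↦ if 0 < x then 1 else 0)
  simpa [numPos, Fintype.card_subtype, Finset.sum_boole] using this

theorem re_dotProduct_mulVec (hX : X.IsHermitian) (x : n → ℂ) :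
    (star x ⬝ᵥ X *ᵥ x).re = ∑ i, hX.eigenvalues i *
      ‖((hX.eigenvectorUnitary : Matrix n n ℂ)ᴴ *ᵥ x) i‖ ^ 2 := by
  set U := (hX.eigenvectorUnitary : Matrix n n ℂ)
  have h : star x ⬝ᵥ X *ᵥ x =
      star (Uᴴ *ᵥ x) ⬝ᵥ diagonal (fun i ↦ (hX.eigenvalues i : ℂ)) *ᵥ (Uᴴ *ᵥ x) := by
    conv_lhs => rw [hX.eq_unitary_mul_diagonal]
    rw [star_mulVec, conjTranspose_conjTranspose, ← dotProduct_mulVec, mulVec_mulVec, mulVec_mulVec,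
      mul_assoc]
  rw [h, dotProduct, Complex.re_sum]
  refine Finset.sum_congr rfl fun i _ ↦ ?_
  rw [mulVec_diagonal, Pi.star_apply, mul_left_comm, ← starRingEnd_apply, Complex.conj_mul']
  norm_cast

/-- A subspace on which the form is positive has dimension at most the number of positive
eigenvalues. -/
theorem finrank_le_numPos (hX : X.IsHermitian) {E : Type*} [AddCommGroup E] [Module ℂ E]
    (f : E →ₗ[ℂ] (n → ℂ)) (hf : ∀ e, e ≠ 0 → 0 < (star (f e) ⬝ᵥ X *ᵥ (f e)).re) :
    Module.finrank ℂ E ≤ hX.numPos := by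
  set U := (hX.eigenvectorUnitary : Matrix n n ℂ) with hU
  -- Keep only the positive eigencoordinates: on a vector where they all vanish the form is
  -- nonpositive, so `g` is injective.
  let g : E →ₗ[ℂ] ({i // 0 < hX.eigenvalues i} → ℂ) :=
    LinearMap.funLeft ℂ ℂ Subtype.val ∘ₗ Uᴴ.mulVecLin ∘ₗ f
  have hg : Function.Injective g := by
    rw [injective_iff_map_eq_zero]
    intro e he
    by_contra hne
    refine (hf e hne).not_ge ?_
    rw [hX.re_dotProduct_mulVec]
    refine Finset.sum_nonpos fun i _ ↦ ?_
    by_cases hi : 0 < hX.eigenvalues i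
    · have h0 : (Uᴴ *ᵥ f e) i = 0 := congrFun he ⟨i, hi⟩
      rw [← hU, h0]
      simp
    · exact mul_nonpos_of_nonpos_of_nonneg (not_lt.1 hi) (by positivity)
  have := LinearMap.finrank_le_finrank_of_injective hg
  rwa [Module.finrank_fintype_fun_eq_card] at this

/-- The eigenvectors with positive eigenvalue span such a subspace, so the bound of
`finrank_le_numPos` is attained. -/
theorem exists_linearMap_pos (hX : X.IsHermitian) :
    ∃ f : ({i // 0 < hX.eigenvalues i} → ℂ) →ₗ[ℂ] (n → ℂ),
      ∀ e, e ≠ 0 → 0 < (star (f e) ⬝ᵥ X *ᵥ (f e)).re := by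
  set U := (hX.eigenvectorUnitary : Matrix n n ℂ) with hU
  refine ⟨U.mulVecLin ∘ₗ Function.ExtendByZero.linearMap ℂ Subtype.val, fun e he ↦ ?_⟩
  rw [hX.re_dotProduct_mulVec]
  obtain ⟨j, hj⟩ := Function.ne_iff.1 he
  simp only [LinearMap.comp_apply, mulVecLin_apply, mulVec_mulVec, ← hU]
  rw [hU, hX.conjTranspose_eigenvectorUnitary_mul, one_mulVec]
  have key (i : {i // 0 < hX.eigenvalues i}) :
      Function.ExtendByZero.linearMap ℂ Subtype.val e i.1 = e i := by
    simp
  refine Finset.sum_pos' (fun i _ ↦ ?_) ⟨j, Finset.mem_univ _, ?_⟩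
  · by_cases hi : 0 < hX.eigenvalues i
    · positivity
    · have : Function.ExtendByZero.linearMap ℂ Subtype.val e i = 0 := by
        simp only [Function.ExtendByZero.linearMap_apply]
        rw [Function.extend_apply' _ _ _ (fun ⟨a, ha⟩ ↦ hi (ha ▸ a.2))]
        rfl
      simp [this]
  · rw [key]
    exact mul_pos j.2 (pow_pos (norm_pos_iff.2 hj) 2)

/-- `T` carries a maximal positive subspace for `X` to one for `Y`; injectivity there is automatic,
since the form of `Y` is positive on the images. -/
theorem numPos_le_of_form (hX : X.IsHermitian) (hY : Y.IsHermitian)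
    (T : (n → ℂ) →ₗ[ℂ] (n → ℂ)) (h : ∀ x, (star x ⬝ᵥ X *ᵥ x).re ≤ (star (T x) ⬝ᵥ Y *ᵥ (T x)).re) :
    hX.numPos ≤ hY.numPos := by
  obtain ⟨f, hf⟩ := hX.exists_linearMap_pos
  have := hY.finrank_le_numPos (T ∘ₗ f) (fun e he ↦ (hf e he).trans_le (h _))
  rwa [Module.finrank_fintype_fun_eq_card] at this

theorem numPos_mono (hX : X.IsHermitian) (hY : Y.IsHermitian) (h : (Y - X).PosSemidef) :
    hX.numPos ≤ hY.numPos := by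
  refine numPos_le_of_form hX hY LinearMap.id fun x ↦ ?_
  have := h.re_dotProduct_nonneg x
  simp only [sub_mulVec, dotProduct_sub] at this
  simpa using this

/-- Sylvester's law of inertia for the number of positive eigenvalues. -/
theorem numPos_congruence (hX : X.IsHermitian) (hY : Y.IsHermitian) {D : Matrix n n ℂ}
    (hD : IsUnit D) (h : X = Dᴴ * Y * D) : hX.numPos = hY.numPos := by
  have key {X Y D : Matrix n n ℂ} (hX : X.IsHermitian) (hY : Y.IsHermitian)
      (h : X = Dᴴ * Y * D) : hX.numPos ≤ hY.numPos := by
    refine numPos_le_of_form hX hY D.mulVecLin fun x ↦ ?_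
    rw [h, mulVecLin_apply, star_mulVec, ← dotProduct_mulVec, mulVec_mulVec, mulVec_mulVec, mul_assoc]
  have hdet := (isUnit_iff_isUnit_det _).1 hD
  refine le_antisymm (key hX hY h) (key (D := D⁻¹) hY hX ?_)
  rw [h, conjTranspose_nonsing_inv]
  have hdet' : IsUnit (Dᴴ).det := by simpa [det_conjTranspose] using hdet
  rw [mul_assoc Dᴴ, nonsing_inv_mul_cancel_left _ _ hdet', mul_nonsing_inv_cancel_right _ _ hdet]

theorem trace_pow_eq_sum (hX : X.IsHermitian) (k : ℕ) :
    (X ^ k).trace = ((∑ i, hX.eigenvalues i ^ k : ℝ) : ℂ) := by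
  set U := (hX.eigenvectorUnitary : Matrix n n ℂ) with hU
  have h : X ^ k = U * diagonal (fun i ↦ (hX.eigenvalues i : ℂ)) ^ k * Uᴴ := by
    have h1 := hX.eq_unitary_mul_diagonal
    have h2 := hX.conjTranspose_eigenvectorUnitary_mul
    rw [← hU] at h1 h2
    generalize diagonal (fun i ↦ (hX.eigenvalues i : ℂ)) = Δ at h1 ⊢
    induction k with
    | zero => simp [hU, hX.eigenvectorUnitary_mul_conjTranspose]
    | succ k ih =>
      calc X ^ (k + 1) = U * Δ ^ k * Uᴴ * (U * Δ * Uᴴ) := by rw [pow_succ, ih, ← h1]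
        _ = U * Δ ^ k * (Uᴴ * U) * Δ * Uᴴ := by simp only [mul_assoc]
        _ = U * Δ ^ (k + 1) * Uᴴ := by rw [h2, mul_one, pow_succ, mul_assoc U]
  rw [h, trace_mul_comm, ← mul_assoc, hU, hX.conjTranspose_eigenvectorUnitary_mul, one_mul,
    diagonal_pow, trace_diagonal]
  simp

end Matrix.IsHermitian

/-! ### Pencils and domination of positive semidefinite matrices -/

namespace Matrix

variable {n : Type*} [Fintype n] [DecidableEq n] {A B : Matrix n n ℂ}

theorem PosSemidef.exists_eq_conjTranspose_mul_self (hA : A.PosSemidef) :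
    ∃ D : Matrix n n ℂ, A = Dᴴ * D := by
  open scoped MatrixOrder in
  obtain ⟨D, rfl⟩ := CStarAlgebra.nonneg_iff_eq_star_mul_self.mp hA.nonneg
  exact ⟨D, rfl⟩

omit [Fintype n] in
theorem PosSemidef.smul_add_smul_one (hB : B.PosSemidef) {a s : ℝ} (ha : 0 ≤ a) (hs : 0 ≤ s) :
    ((a : ℂ) • B + (s : ℂ) • (1 : Matrix n n ℂ)).PosSemidef :=
  (hB.smul (by exact_mod_cast ha)).add (PosSemidef.one.smul (by exact_mod_cast hs))

omit [Fintype n] in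
theorem PosSemidef.add_smul_one_posDef (hB : B.PosSemidef) {s : ℝ} (hs : 0 < s) :
    (B + (s : ℂ) • (1 : Matrix n n ℂ)).PosDef :=
  PosDef.posSemidef_add hB (PosDef.one.smul (by exact_mod_cast hs))

/-- For `A ≥ 0` and `B > 0`, the pencil `A - γ B` is governed by the eigenvalues of
`B^{-1/2} A B^{-1/2}`. -/
theorem exists_pencil_eigenvalues (hA : A.PosSemidef) (hB : B.PosDef) :
    ∃ μ : n → ℝ, (∀ i, 0 ≤ μ i) ∧
      (∀ (γ : ℝ) (h : (A - (γ : ℂ) • B).IsHermitian),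
        h.numPos = Fintype.card {i // γ < μ i}) ∧
      ∀ k : ℕ, ((A * B⁻¹) ^ k).trace = ((∑ i, μ i ^ k : ℝ) : ℂ) := by
  obtain ⟨D, rfl⟩ := hB.posSemidef.exists_eq_conjTranspose_mul_self
  have hdet : IsUnit D.det := by
    have := (isUnit_iff_isUnit_det _).1 hB.isUnit
    rw [det_mul] at this
    exact isUnit_of_mul_isUnit_right this
  have hdet' : IsUnit (Dᴴ).det := by simpa [det_conjTranspose] using hdet
  -- With `B = Dᴴ D`, the factor `D` replaces `B^{1/2}`: `A - γB = Dᴴ (Z - γ) D` is a congruence,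
  -- while `A B⁻¹` is similar to `Z`.
  set Z : Matrix n n ℂ := (D⁻¹)ᴴ * A * D⁻¹ with hZ
  have hZp : Z.PosSemidef := hA.conjTranspose_mul_mul_same _
  have hAZ : A = Dᴴ * Z * D := by
    rw [hZ, conjTranspose_nonsing_inv, mul_assoc _ A, mul_nonsing_inv_cancel_left _ _ hdet',
      nonsing_inv_mul_cancel_right _ _ hdet]
  refine ⟨hZp.isHermitian.eigenvalues, hZp.eigenvalues_nonneg, fun γ h ↦ ?_, fun k ↦ ?_⟩
  · have hW : (Z - (γ : ℂ) • (1 : Matrix n n ℂ)).IsHermitian := by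
      refine hZp.isHermitian.sub ?_
      simp [IsHermitian, conjTranspose_smul]
    rw [h.numPos_congruence hW ((isUnit_iff_isUnit_det _).2 hdet),
      hZp.isHermitian.numPos_affine 1 (-γ) hW]
    · simp
    · simp [sub_eq_add_neg]
    · rw [mul_sub, sub_mul, ← hAZ]
      simp
  · rw [← hZp.isHermitian.trace_pow_eq_sum, Matrix.mul_inv_rev]
    have h1 : (A * (D⁻¹ * (Dᴴ)⁻¹)) ^ k = Dᴴ * Z ^ k * (Dᴴ)⁻¹ := by
      induction k with
      | zero => simp [mul_nonsing_inv _ hdet']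
      | succ k ih =>
        rw [pow_succ, ih, pow_succ]
        simp only [mul_assoc]
        rw [hZ, conjTranspose_nonsing_inv]
        simp only [mul_assoc]
    rw [h1, trace_mul_comm, nonsing_inv_mul_cancel_left _ _ hdet']

/-- If the range of `A ≥ 0` is contained in that of `B ≥ 0`, then `A ≤ c B` for some `c`. -/
theorem PosSemidef.exists_le_smul_of_range_le (hA : A.PosSemidef) (hB : B.PosSemidef)
    (h : LinearMap.range A.mulVecLin ≤ LinearMap.range B.mulVecLin) :
    ∃ c : ℝ, 0 ≤ c ∧ ((c : ℂ) • B - A).PosSemidef := by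
  obtain ⟨D, rfl⟩ := hB.exists_eq_conjTranspose_mul_self
  obtain ⟨R, rfl⟩ := hA.exists_eq_conjTranspose_mul_self
  -- Range inclusion dualizes to kernel inclusion, which makes `R` factor through `D`.
  have hker (x : n → ℂ) (hx : D *ᵥ x = 0) : R *ᵥ x = 0 := by
    have h2 (y : n → ℂ) : star x ⬝ᵥ (Rᴴ * R) *ᵥ y = 0 := by
      obtain ⟨z, hz⟩ := h ⟨y, rfl⟩
      simp only [mulVecLin_apply] at hz
      rw [← hz, ← mulVec_mulVec, dotProduct_mulVec, ← star_mulVec, hx]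
      simp
    have h3 := h2 x
    rw [← mulVec_mulVec, dotProduct_mulVec, ← star_mulVec] at h3
    exact dotProduct_star_self_eq_zero.1 h3
  obtain ⟨L, hL⟩ : ∃ L : Matrix n n ℂ, R = L * D := by
    obtain ⟨g, hg⟩ := D.mulVecLin.rangeRestrict.exists_rightInverse_of_surjective
      (LinearMap.range_rangeRestrict _)
    obtain ⟨G, hG⟩ := LinearMap.exists_extend g
    refine ⟨R * LinearMap.toMatrix' G, ?_⟩
    refine Matrix.mulVec_injective (funext fun x ↦ ?_)
    have h1 : D *ᵥ (G (D *ᵥ x)) = D *ᵥ x := by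
      have e1 : G (D *ᵥ x) = g ⟨D *ᵥ x, x, rfl⟩ :=
        LinearMap.congr_fun hG (⟨D *ᵥ x, x, rfl⟩ : LinearMap.range D.mulVecLin)
      rw [e1]
      exact congrArg Subtype.val
        (LinearMap.congr_fun hg (⟨D *ᵥ x, x, rfl⟩ : LinearMap.range D.mulVecLin))
    have h2 := hker (G (D *ᵥ x) - x) (by rw [mulVec_sub, h1, sub_self])
    rw [mulVec_sub, sub_eq_zero] at h2
    rw [← mulVec_mulVec, ← mulVec_mulVec, LinearMap.toMatrix'_mulVec, h2]
  -- The trace of `Lᴴ L` dominates each of its eigenvalues; conjugating by `D` then gives the claim.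
  obtain ⟨c, hc0, hc⟩ : ∃ c : ℝ, 0 ≤ c ∧ ((c : ℂ) • (1 : Matrix n n ℂ) - Lᴴ * L).PosSemidef := by
    have hP : (Lᴴ * L).PosSemidef := posSemidef_conjTranspose_mul_self L
    set d := hP.isHermitian.eigenvalues with hd
    refine ⟨∑ i, d i, Finset.sum_nonneg fun i _ ↦ hP.eigenvalues_nonneg i, ?_⟩
    have hh : (((∑ i, d i : ℝ) : ℂ) • (1 : Matrix n n ℂ) - Lᴴ * L).IsHermitian := by
      refine IsHermitian.sub ?_ hP.isHermitian
      simp [IsHermitian, conjTranspose_smul]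
    rw [hh.posSemidef_iff_eigenvalues_nonneg]
    have h1 := hP.isHermitian.sum_eigenvalues_affine (-1) (∑ i, d i) hh
      (by simp [sub_eq_add_neg, add_comm]) (fun x ↦ if x < 0 then 1 else 0)
    have h2 : ∑ i, (if -1 * hP.isHermitian.eigenvalues i + ∑ i, d i < 0 then 1 else 0) = 0 := by
      refine Finset.sum_eq_zero fun i _ ↦ if_neg ?_
      have := Finset.single_le_sum (fun i _ ↦ hP.eigenvalues_nonneg i) (Finset.mem_univ i)
      rw [← hd] at this ⊢
      linarith
    rw [h2] at h1
    intro i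
    have := (Finset.sum_eq_zero_iff.1 h1) i (Finset.mem_univ _)
    simpa using this
  refine ⟨c, hc0, ?_⟩
  have := hc.conjTranspose_mul_mul_same D
  rw [mul_sub, sub_mul] at this
  rw [hL, conjTranspose_mul]
  simpa [mul_assoc] using this

end Matrix

/-! ### Layer-cake integrals and joint measurability -/

theorem coe_card_subtype_eq_sum {ι : Type*} [Fintype ι] (p : ι → Prop) [DecidablePred p] :
    ((Fintype.card {i // p i} : ℕ) : ℝ≥0∞) = ∑ i, if p i then 1 else 0 := by
  simp [Fintype.card_subtype]

theorem lintegral_Ioi_ite_mul_lt {c : ℝ} (hc : 0 < c) (l : ℝ) :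
    ∫⁻ u in Ioi (0 : ℝ), (if c * u < l then (1 : ℝ≥0∞) else 0) = ENNReal.ofReal (l / c) := by
  have h : (fun u : ℝ ↦ if c * u < l then (1 : ℝ≥0∞) else 0) =
      (Iio (l / c)).indicator (fun _ ↦ 1) := by
    ext u
    simp [indicator, lt_div_iff₀ hc, mul_comm]
  rw [h, lintegral_indicator_const measurableSet_Iio, Measure.restrict_apply measurableSet_Iio,
    Iio_inter_Ioi, Real.volume_Ioo]
  simp

theorem lintegral_Ioi_ite_lt_pow (l : ℝ) (hl : 0 ≤ l) {k : ℕ} (hk : 0 < k) :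
    ∫⁻ γ in Ioi (0 : ℝ), ENNReal.ofReal (k * γ ^ (k - 1)) * (if γ < l then (1 : ℝ≥0∞) else 0) =
      ENNReal.ofReal (l ^ k) := by
  have h : (fun γ : ℝ ↦ ENNReal.ofReal (k * γ ^ (k - 1)) * (if γ < l then (1 : ℝ≥0∞) else 0)) =
      (Iio l).indicator (fun γ ↦ ENNReal.ofReal (k * γ ^ (k - 1))) := by
    ext u
    simp [indicator]
  have hcont : Continuous fun γ : ℝ ↦ (k : ℝ) * γ ^ (k - 1) := by fun_prop
  rw [h, lintegral_indicator measurableSet_Iio, Measure.restrict_restrict measurableSet_Iio,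
    Iio_inter_Ioi, ← ofReal_integral_eq_lintegral_ofReal]
  · rw [← integral_Ioc_eq_integral_Ioo, ← intervalIntegral.integral_of_le hl,
      intervalIntegral.integral_const_mul, integral_pow]
    congr 1
    have : ((k - 1 : ℕ) : ℝ) + 1 = k := by exact_mod_cast Nat.sub_add_cancel hk
    rw [this, Nat.sub_add_cancel hk, zero_pow hk.ne']
    field_simp
    simp
  · exact (hcont.integrableOn_Icc (a := 0) (b := l)).mono_set Ioo_subset_Icc_self
  · filter_upwards [ae_restrict_mem measurableSet_Ioo] with γ hγ
    have := hγ.1.le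
    positivity

/-- Each superlevel set is a countable union of rectangles with a rational edge `r`; `h3`, a form of
right continuity in `u`, leaves room for `r`. -/
theorem measurable_uncurry_of_antitone_of_exists_gt {G : ℝ → ℝ → ℕ}
    (h1 : ∀ u, Antitone fun γ ↦ G γ u) (h2 : ∀ γ, Antitone (G γ))
    (h3 : ∀ γ u, ∃ v > u, G γ u ≤ G γ v) : Measurable (Function.uncurry G) := by
  refine measurable_of_Ici fun m ↦ ?_
  have h : Function.uncurry G ⁻¹' Ici m =
      ⋃ r : ℚ, ((fun γ ↦ G γ r) ⁻¹' Ici m) ×ˢ Iio (r : ℝ) := by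
    ext ⟨γ, u⟩
    simp only [mem_preimage, Function.uncurry_apply_pair, mem_Ici, mem_iUnion, mem_prod, mem_Iio]
    constructor
    · intro hm
      obtain ⟨v, hv, hle⟩ := h3 γ u
      obtain ⟨r, hur, hrv⟩ := exists_rat_btwn hv
      exact ⟨r, (hm.trans hle).trans (h2 γ hrv.le), hur⟩
    · rintro ⟨r, hr, hur⟩
      exact hr.trans (h2 γ hur.le)
  rw [h]
  exact .iUnion fun r ↦ ((h1 r).measurable measurableSet_Ici).prod measurableSet_Iio

/-! ### The trace of the positive part -/

section trPosPart

open Matrix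

variable {n : Type*} [Fintype n] [DecidableEq n] {X Y : Matrix n n ℂ}

theorem trPosPart_nonneg (hX : X.IsHermitian) : 0 ≤ trPosPart hX :=
  Finset.sum_nonneg fun _ _ ↦ le_max_right _ _

/-- Layer cake for each eigenvalue. The scale `c` will be `γ`, so that the threshold `γu` matches `ρ
- γ(σ + u)`. -/
theorem ofReal_trPosPart (hX : X.IsHermitian) {c : ℝ} (hc : 0 < c) :
    ENNReal.ofReal (trPosPart hX) = ENNReal.ofReal c *
      ∫⁻ u in Ioi (0 : ℝ), (Fintype.card {i // c * u < hX.eigenvalues i} : ℝ≥0∞) := by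
  simp_rw [coe_card_subtype_eq_sum]
  rw [lintegral_finsetSum]
  · simp_rw [lintegral_Ioi_ite_mul_lt hc]
    rw [trPosPart, ENNReal.ofReal_sum_of_nonneg fun i _ ↦ le_max_right _ _, Finset.mul_sum]
    refine Finset.sum_congr rfl fun i _ ↦ ?_
    rw [← ENNReal.ofReal_mul hc.le, mul_div_cancel₀ _ hc.ne']
    rcases le_total 0 (hX.eigenvalues i) with h | h
    · rw [max_eq_left h]
    · rw [max_eq_right h, ENNReal.ofReal_of_nonpos h, ENNReal.ofReal_zero]
  · intro i _
    exact Measurable.ite (measurableSet_lt (by fun_prop) (by fun_prop)) measurable_const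
      measurable_const

theorem numPos_sub_smul_one (hX : X.IsHermitian) (s : ℝ)
    (hY : (X - (s : ℂ) • (1 : Matrix n n ℂ)).IsHermitian) :
    hY.numPos = Fintype.card {i // s < hX.eigenvalues i} := by
  rw [hX.numPos_affine 1 (-s) hY (by simp [sub_eq_add_neg])]
  simp

omit [Fintype n] in
theorem isHermitian_sub_smul_one (hX : X.IsHermitian) (s : ℝ) :
    (X - (s : ℂ) • (1 : Matrix n n ℂ)).IsHermitian := by
  refine hX.sub ?_
  simp [Matrix.IsHermitian, conjTranspose_smul]

theorem trPosPart_mono (hX : X.IsHermitian) (hY : Y.IsHermitian) (h : (Y - X).PosSemidef) :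
    trPosPart hX ≤ trPosPart hY := by
  rw [← ENNReal.ofReal_le_ofReal_iff (trPosPart_nonneg hY), ofReal_trPosPart hX one_pos,
    ofReal_trPosPart hY one_pos]
  gcongr with u
  simp only [one_mul]
  rw [← numPos_sub_smul_one hX u (isHermitian_sub_smul_one hX u),
    ← numPos_sub_smul_one hY u (isHermitian_sub_smul_one hY u)]
  exact IsHermitian.numPos_mono _ _ (by simpa using h)

theorem trPosPart_smul (hX : X.IsHermitian) (hY : Y.IsHermitian) {a : ℝ} (ha : 0 ≤ a)
    (h : Y = (a : ℂ) • X) : trPosPart hY = a * trPosPart hX := by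
  rw [trPosPart, hX.sum_eigenvalues_affine a 0 hY (by simp [h]) (fun x ↦ max x 0), trPosPart,
    Finset.mul_sum]
  refine Finset.sum_congr rfl fun i _ ↦ ?_
  rw [add_zero, mul_max_of_nonneg _ _ ha, mul_zero]

theorem trPosPart_neg (hX : X.IsHermitian) (hY : Y.IsHermitian) (h : Y = -X) :
    trPosPart hX = trPosPart hY + X.trace.re := by
  rw [trPosPart, trPosPart, hX.sum_eigenvalues_affine (-1) 0 hY (by simp [h]) (fun x ↦ max x 0),
    hX.trace_eq_sum_eigenvalues, Complex.re_sum, ← Finset.sum_add_distrib]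
  refine Finset.sum_congr rfl fun i _ ↦ ?_
  rcases le_total 0 (hX.eigenvalues i) with h | h <;> simp [h]

end trPosPart

/-! ### Hockey-stick divergences and the Tonelli exchange -/

section hockeyStick

open Matrix

variable {n : Type*} [Fintype n] [DecidableEq n]

theorem hockeyStick_nonneg (γ : ℝ) (ρ σ : QState n) : 0 ≤ hockeyStick γ ρ σ :=
  trPosPart_nonneg _

theorem antitone_hockeyStick (ρ σ : QState n) : Antitone fun γ ↦ hockeyStick γ ρ σ := by
  intro γ γ' h
  refine trPosPart_mono _ _ ?_
  have : (0 : ℂ) ≤ ((γ' - γ : ℝ) : ℂ) := by exact_mod_cast sub_nonneg.2 h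
  have := σ.posSemidef.smul this
  rwa [Complex.ofReal_sub, sub_smul, ← sub_sub_sub_cancel_left _ _ ρ.mat] at this

/-- `E_{1/u}(σ‖ρ)` in terms of `E_u(ρ‖σ)`. -/
theorem hockeyStick_inv (ρ σ : QState n) {u : ℝ} (hu : 0 < u) :
    u * hockeyStick u⁻¹ σ ρ + (1 - u) = hockeyStick u ρ σ := by
  have hneg : (-(ρ.mat - (u : ℂ) • σ.mat)).IsHermitian := (ρ.isHermitian_sub_smul σ u).neg
  have hu' : (u : ℂ) ≠ 0 := by exact_mod_cast hu.ne'
  rw [hockeyStick, hockeyStick, trPosPart_neg (ρ.isHermitian_sub_smul σ u) hneg rfl,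
    trPosPart_smul (σ.isHermitian_sub_smul ρ u⁻¹) hneg hu.le]
  · simp [trace_sub, trace_smul, ρ.trace_eq_one, σ.trace_eq_one]
  · rw [smul_sub, smul_smul, Complex.ofReal_inv, mul_inv_cancel₀ hu', one_smul, neg_sub]

/-- The number of positive eigenvalues of `ρ - γ (σ + u)`, for `γ, u ≥ 0`. -/
def pencilCount (ρ σ : QState n) (γ u : ℝ) : ℕ :=
  Fintype.card {i // max γ 0 * max u 0 < (ρ.isHermitian_sub_smul σ (max γ 0)).eigenvalues i}

theorem isHermitian_pencil (ρ σ : QState n) (γ u : ℝ) :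
    (ρ.mat - (γ : ℂ) • (σ.mat + (u : ℂ) • (1 : Matrix n n ℂ))).IsHermitian := by
  have := isHermitian_sub_smul_one (ρ.isHermitian_sub_smul σ γ) (γ * u)
  rwa [sub_sub, Complex.ofReal_mul, mul_smul, ← smul_add] at this

theorem pencilCount_eq (ρ σ : QState n) (γ u : ℝ) :
    pencilCount ρ σ γ u = (isHermitian_pencil ρ σ (max γ 0) (max u 0)).numPos := by
  have h : ρ.mat - ((max γ 0 : ℝ) : ℂ) • σ.mat -
      ((max γ 0 * max u 0 : ℝ) : ℂ) • (1 : Matrix n n ℂ) =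
      ρ.mat - ((max γ 0 : ℝ) : ℂ) • (σ.mat + ((max u 0 : ℝ) : ℂ) • (1 : Matrix n n ℂ)) := by
    rw [sub_sub, Complex.ofReal_mul, mul_smul, ← smul_add]
  rw [pencilCount, ← numPos_sub_smul_one _ _ (h ▸ isHermitian_pencil ρ σ (max γ 0) (max u 0))]
  congr!

/-- Truncating both variables at `0` makes the count antitone in each on all of `ℝ`. The finitely
many strict inequalities survive a small increase of `u`. -/
theorem measurable_pencilCount (ρ σ : QState n) :
    Measurable (Function.uncurry (pencilCount ρ σ)) := by
  refine measurable_uncurry_of_antitone_of_exists_gt (fun u γ γ' h ↦ ?_) (fun γ u u' h ↦ ?_)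
    fun γ u ↦ ?_
  · simp only [pencilCount_eq]
    refine IsHermitian.numPos_mono _ _ ?_
    rw [sub_sub_sub_cancel_left, ← sub_smul, ← Complex.ofReal_sub]
    have h1 : max γ 0 ≤ max γ' 0 := max_le_max_right 0 h
    have h2 := σ.posSemidef.smul_add_smul_one zero_le_one (le_max_right u 0)
    rw [Complex.ofReal_one, one_smul] at h2
    exact h2.smul (by exact_mod_cast sub_nonneg.2 h1)
  · refine Fintype.card_subtype_mono _ _ fun i hi ↦ lt_of_le_of_lt ?_ hi
    gcongr
  · have hev : ∀ᶠ v in nhdsWithin u (Ioi u), ∀ i,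
        max γ 0 * max u 0 < (ρ.isHermitian_sub_smul σ (max γ 0)).eigenvalues i →
        max γ 0 * max v 0 < (ρ.isHermitian_sub_smul σ (max γ 0)).eigenvalues i := by
      refine Filter.eventually_all.2 fun i ↦ ?_
      by_cases hi : max γ 0 * max u 0 < (ρ.isHermitian_sub_smul σ (max γ 0)).eigenvalues i
      · have hc : Continuous fun v : ℝ ↦ max γ 0 * max v 0 := by fun_prop
        filter_upwards [nhdsWithin_le_nhds (hc.continuousAt.eventually_lt_const hi)] with v hv _
        exact hv
      · exact .of_forall fun v h ↦ absurd h hi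
    obtain ⟨v, hv, huv⟩ := (hev.and self_mem_nhdsWithin).exists
    exact ⟨v, huv, Fintype.card_subtype_mono _ _ hv⟩

theorem ofReal_hockeyStick (ρ σ : QState n) {γ : ℝ} (hγ : 0 < γ) :
    ENNReal.ofReal (hockeyStick γ ρ σ) =
      ENNReal.ofReal γ * ∫⁻ u in Ioi (0 : ℝ), (pencilCount ρ σ γ u : ℝ≥0∞) := by
  rw [hockeyStick, ofReal_trPosPart _ hγ]
  congr 1
  refine setLIntegral_congr_fun measurableSet_Ioi fun u hu ↦ ?_
  simp only [pencilCount, max_eq_left hγ.le, max_eq_left (le_of_lt (mem_Ioi.1 hu))]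

theorem exists_pencilCount_eigenvalues (ρ σ : QState n) {u : ℝ} (hu : 0 < u) :
    ∃ μ : n → ℝ, (∀ i, 0 ≤ μ i) ∧
      (∀ γ, 0 < γ → pencilCount ρ σ γ u = Fintype.card {i // γ < μ i}) ∧
      ∀ k : ℕ, resolventTrace k ρ σ u = ((∑ i, μ i ^ k : ℝ) : ℂ) := by
  obtain ⟨μ, h0, h1, h2⟩ :=
    exists_pencil_eigenvalues ρ.posSemidef (σ.posSemidef.add_smul_one_posDef hu)
  refine ⟨μ, h0, fun γ hγ ↦ ?_, h2⟩
  rw [pencilCount_eq, ← h1 γ (isHermitian_pencil ρ σ γ u)]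
  congr 1; simp [hγ.le, hu.le]

theorem resolventTrace_im_eq_zero_and_re_nonneg (k : ℕ) (ρ σ : QState n) {s : ℝ} (hs : 0 < s) :
    (resolventTrace k ρ σ s).im = 0 ∧ 0 ≤ (resolventTrace k ρ σ s).re := by
  obtain ⟨μ, h0, -, h2⟩ := exists_pencilCount_eigenvalues ρ σ hs
  rw [h2 k, Complex.ofReal_im, Complex.ofReal_re]
  exact ⟨rfl, Finset.sum_nonneg fun i _ ↦ pow_nonneg (h0 i) k⟩

theorem lintegral_pencilCount (ρ σ : QState n) {u : ℝ} (hu : 0 < u) {k : ℕ} (hk : 0 < k) :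
    ∫⁻ γ in Ioi (0 : ℝ), ENNReal.ofReal (k * γ ^ (k - 1)) * (pencilCount ρ σ γ u : ℝ≥0∞) =
      ENNReal.ofReal (resolventTrace k ρ σ u).re := by
  obtain ⟨μ, h0, h1, h2⟩ := exists_pencilCount_eigenvalues ρ σ hu
  rw [h2 k, Complex.ofReal_re, ENNReal.ofReal_sum_of_nonneg fun i _ ↦ pow_nonneg (h0 i) k,
    setLIntegral_congr_fun measurableSet_Ioi (g := fun γ ↦ ∑ i,
      ENNReal.ofReal (k * γ ^ (k - 1)) * (if γ < μ i then 1 else 0))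
      (fun γ hγ ↦ by simp only [h1 γ hγ, coe_card_subtype_eq_sum, Finset.mul_sum]),
    lintegral_finsetSum]
  · exact Finset.sum_congr rfl fun i _ ↦ lintegral_Ioi_ite_lt_pow _ (h0 i) hk
  · intro i _
    refine Measurable.mul (by fun_prop) ?_
    exact Measurable.ite (measurableSet_lt (by fun_prop) (by fun_prop)) measurable_const
      measurable_const

theorem measurable_weighted_pencilCount (ρ σ : QState n) (k : ℕ) :
    Measurable (Function.uncurry fun γ u : ℝ ↦
      ENNReal.ofReal (k * γ ^ (k - 1)) * (pencilCount ρ σ γ u : ℝ≥0∞)) := by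
  refine Measurable.mul (f := fun p : ℝ × ℝ ↦ ENNReal.ofReal (k * p.1 ^ (k - 1)))
    (by fun_prop) ?_
  exact (measurable_from_top (f := fun m : ℕ ↦ (m : ℝ≥0∞))).comp (measurable_pencilCount ρ σ)

/-- `k ∫ γ^{k-2} E_γ(ρ‖σ) dγ = ∫ Tr[(ρ (σ + s)⁻¹)^k] ds`. -/
theorem lintegral_hockeyStick_eq_lintegral_resolventTrace (ρ σ : QState n) {k : ℕ} (hk : 2 ≤ k) :
    ∫⁻ γ in Ioi (0 : ℝ), ENNReal.ofReal (k * γ ^ (k - 2) * hockeyStick γ ρ σ) =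
      ∫⁻ s in Ioi (0 : ℝ), ENNReal.ofReal (resolventTrace k ρ σ s).re := by
  have hm := measurable_weighted_pencilCount ρ σ k
  calc
    _ = ∫⁻ γ in Ioi (0 : ℝ), ∫⁻ u in Ioi (0 : ℝ),
          ENNReal.ofReal (k * γ ^ (k - 1)) * (pencilCount ρ σ γ u : ℝ≥0∞) := by
      refine setLIntegral_congr_fun measurableSet_Ioi fun γ hγ ↦ ?_
      have hγ' : 0 < γ := hγ
      rw [lintegral_const_mul' _ _ ENNReal.ofReal_ne_top, ENNReal.ofReal_mul (by positivity),
        ofReal_hockeyStick ρ σ hγ', ← mul_assoc, ← ENNReal.ofReal_mul (by positivity), mul_assoc,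
        ← pow_succ, show k - 2 + 1 = k - 1 by omega]
    _ = ∫⁻ u in Ioi (0 : ℝ), ∫⁻ γ in Ioi (0 : ℝ),
          ENNReal.ofReal (k * γ ^ (k - 1)) * (pencilCount ρ σ γ u : ℝ≥0∞) :=
      lintegral_lintegral_swap hm.aemeasurable
    _ = _ := setLIntegral_congr_fun measurableSet_Ioi fun u hu ↦
      lintegral_pencilCount ρ σ hu (by omega)

/-- For `supp ρ ⊆ supp σ` the integral is finite. -/
theorem lintegral_hockeyStick_ne_top (ρ σ : QState n) (h : ρ.SuppLE σ) (k : ℕ) :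
    ∫⁻ γ in Ioi (0 : ℝ), ENNReal.ofReal (k * γ ^ (k - 2) * hockeyStick γ ρ σ) ≠ ∞ := by
  obtain ⟨c, hc0, hc⟩ := ρ.posSemidef.exists_le_smul_of_range_le σ.posSemidef h
  -- Beyond `c` one has `ρ - γσ ≤ 0`, so the integrand is bounded with bounded support.
  have hzero (γ : ℝ) (hγ : c ≤ γ) : hockeyStick γ ρ σ = 0 := by
    refine le_antisymm ?_ (hockeyStick_nonneg γ ρ σ)
    refine (antitone_hockeyStick ρ σ hγ).trans ?_
    refine (trPosPart_mono (ρ.isHermitian_sub_smul σ c) Matrix.isHermitian_zero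
      (by simpa using hc)).trans ?_
    rw [trPosPart]
    simp [Matrix.isHermitian_zero.eigenvalues_eq_zero_iff.2 rfl]
  have hle : ∫⁻ γ in Ioi (0 : ℝ), ENNReal.ofReal (k * γ ^ (k - 2) * hockeyStick γ ρ σ) ≤
      ∫⁻ _ in Iio c ∩ Ioi (0 : ℝ), ENNReal.ofReal (k * c ^ (k - 2) * hockeyStick 0 ρ σ) := by
    rw [← Measure.restrict_restrict measurableSet_Iio, ← lintegral_indicator measurableSet_Iio]
    refine setLIntegral_mono' measurableSet_Ioi fun γ hγ ↦ ?_
    have hγ' : (0 : ℝ) ≤ γ := le_of_lt hγ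
    by_cases hγc : γ < c
    · rw [indicator_of_mem (by exact hγc)]
      have := hockeyStick_nonneg γ ρ σ
      have := antitone_hockeyStick ρ σ hγ'
      simp only at this
      gcongr
    · rw [hzero γ (not_lt.1 hγc)]
      simp
  refine ne_top_of_le_ne_top ?_ hle
  rw [setLIntegral_const, Iio_inter_Ioi, Real.volume_Ioo]
  exact ENNReal.mul_ne_top ENNReal.ofReal_ne_top ENNReal.ofReal_ne_top

end hockeyStick

/-! ### The Hellinger divergence as one integral over `(0, ∞)` -/

theorem iteratedDeriv_two_hellingerFun {k : ℕ} (hk : 2 ≤ k) (x : ℝ) :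
    iteratedDeriv 2 (hellingerFun k) x = k * x ^ (k - 2) := by
  have h : hellingerFun k = fun x : ℝ ↦ (x ^ k - 1) / ((k : ℝ) - 1) := by
    ext x
    rw [hellingerFun, Real.rpow_natCast]
  have h1 : deriv (hellingerFun k) = fun x : ℝ ↦ k * x ^ (k - 1) / ((k : ℝ) - 1) := by
    ext x
    rw [h]
    simp
  have hk' : (k : ℝ) - 1 ≠ 0 := by
    have : (2 : ℝ) ≤ k := by exact_mod_cast hk
    linarith
  rw [iteratedDeriv_succ, iteratedDeriv_one, h1]
  have hcast : ((k - 1 : ℕ) : ℝ) = k - 1 := by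
    rw [Nat.cast_sub (by omega), Nat.cast_one]
  simp only [deriv_div_const, deriv_const_mul_field', deriv_fun_pow, differentiableAt_fun_id, deriv_id'',
    hcast, show k - 1 - 1 = k - 2 by omega]
  field_simp

section

variable {n : Type*} [Fintype n] [DecidableEq n]

theorem image_inv_Ioi_one : (fun x : ℝ ↦ x⁻¹) '' Ioi 1 = Ioo 0 1 := by
  rw [image_inv_eq_inv, inv_Ioi₀ one_pos, inv_one]

/-- Substitute `u = γ⁻¹`: the Jacobian absorbs `γ⁻²` of `γ⁻³`, and the remaining `γ⁻¹` is the factor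
`u` needed by `hockeyStick_inv`. -/
theorem setLIntegral_Ioi_one_inv {k : ℕ} (hk : 2 ≤ k) (ρ σ : QState n) :
    ∫⁻ γ in Ioi (1 : ℝ), ENNReal.ofReal ((γ ^ 3)⁻¹ * (k * γ⁻¹ ^ (k - 2)) * hockeyStick γ σ ρ) =
      ∫⁻ u in Ioo (0 : ℝ) 1, ENNReal.ofReal (k * u ^ (k - 2) * (u * hockeyStick u⁻¹ σ ρ)) := by
  rw [← image_inv_Ioi_one, lintegral_image_eq_lintegral_abs_deriv_mul measurableSet_Ioi
    (f' := fun x ↦ -(x ^ 2)⁻¹)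
    (fun x hx ↦ (hasDerivAt_inv (by have := mem_Ioi.1 hx; positivity)).hasDerivWithinAt)
    inv_injective.injOn]
  refine setLIntegral_congr_fun measurableSet_Ioi fun x hx ↦ ?_
  have hx0 : 0 < x := one_pos.trans hx
  simp only [abs_neg]
  rw [← ENNReal.ofReal_mul (abs_nonneg _), abs_of_pos (by positivity), inv_inv]
  congr 1
  field_simp

theorem setLIntegral_Ioo_pow_mul_one_sub {k : ℕ} (hk : 2 ≤ k) :
    ∫⁻ u in Ioo (0 : ℝ) 1, ENNReal.ofReal (k * u ^ (k - 2) * (1 - u)) =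
      ENNReal.ofReal (1 / ((k : ℝ) - 1)) := by
  have hcont : Continuous fun u : ℝ ↦ (k : ℝ) * u ^ (k - 2) * (1 - u) := by fun_prop
  have hk' : (2 : ℝ) ≤ k := by exact_mod_cast hk
  rw [← ofReal_integral_eq_lintegral_ofReal]
  · rw [← integral_Ioc_eq_integral_Ioo, ← intervalIntegral.integral_of_le zero_le_one]
    have h : (fun u : ℝ ↦ (k : ℝ) * u ^ (k - 2) * (1 - u)) =
        fun u : ℝ ↦ (k : ℝ) * (u ^ (k - 2) - u ^ (k - 1)) := by
      ext u
      rw [show k - 1 = k - 2 + 1 by omega]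
      ring
    rw [h, intervalIntegral.integral_const_mul, intervalIntegral.integral_sub
      ((continuous_pow _).intervalIntegrable _ _) ((continuous_pow _).intervalIntegrable _ _),
      integral_pow, integral_pow, Nat.cast_sub hk, Nat.cast_sub (by omega : 1 ≤ k)]
    congr 1
    have h1 : (k : ℝ) - 1 ≠ 0 := by linarith
    have h2 : (k : ℝ) - 2 + 1 ≠ 0 := by linarith
    have h3 : (k : ℝ) ≠ 0 := by linarith
    simp
    field_simp
    ring
  · exact (hcont.integrableOn_Icc (a := 0) (b := 1)).mono_set Ioo_subset_Icc_self
  · filter_upwards [ae_restrict_mem measurableSet_Ioo] with u hu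
    have := hu.1.le
    have := sub_nonneg.2 hu.2.le
    positivity

/-- The constant is added on the left because truncated subtraction in `ℝ≥0∞` would lose
information. -/
theorem hellinger_add_eq_lintegral_hockeyStick {k : ℕ} (hk : 2 ≤ k) (ρ σ : QState n) :
    hellinger k ρ σ + ENNReal.ofReal (1 / ((k : ℝ) - 1)) =
      ∫⁻ γ in Ioi (0 : ℝ), ENNReal.ofReal (k * γ ^ (k - 2) * hockeyStick γ ρ σ) := by
  have hmeas : Measurable fun γ ↦ hockeyStick γ ρ σ := (antitone_hockeyStick ρ σ).measurable
  have hsplit : hellinger k ρ σ =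
      (∫⁻ γ in Ioi (1 : ℝ), ENNReal.ofReal (k * γ ^ (k - 2) * hockeyStick γ ρ σ)) +
      ∫⁻ γ in Ioi (1 : ℝ),
        ENNReal.ofReal ((γ ^ 3)⁻¹ * (k * γ⁻¹ ^ (k - 2)) * hockeyStick γ σ ρ) := by
    rw [hellinger, fDivergence, ← lintegral_add_left (by fun_prop)]
    refine setLIntegral_congr_fun measurableSet_Ioi fun γ hγ ↦ ?_
    have hγ0 : 0 < γ := one_pos.trans hγ
    have := hockeyStick_nonneg γ ρ σ
    have := hockeyStick_nonneg γ σ ρ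
    simp only [iteratedDeriv_two_hellingerFun hk]
    rw [ENNReal.ofReal_add (by positivity) (by positivity)]
  have hlow : (∫⁻ u in Ioo (0 : ℝ) 1, ENNReal.ofReal (k * u ^ (k - 2) * (u * hockeyStick u⁻¹ σ ρ)))
      + ENNReal.ofReal (1 / ((k : ℝ) - 1)) =
      ∫⁻ u in Ioc (0 : ℝ) 1, ENNReal.ofReal (k * u ^ (k - 2) * hockeyStick u ρ σ) := by
    rw [← setLIntegral_Ioo_pow_mul_one_sub hk, ← lintegral_add_right _ (by fun_prop),
      ← setLIntegral_congr Ioo_ae_eq_Ioc]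
    refine setLIntegral_congr_fun measurableSet_Ioo fun u hu ↦ ?_
    have hu0 := hu.1
    have hu1 := sub_nonneg.2 hu.2.le
    have := hockeyStick_nonneg u⁻¹ σ ρ
    rw [← ENNReal.ofReal_add (by positivity) (by positivity), ← mul_add, hockeyStick_inv ρ σ hu0]
  rw [hsplit, setLIntegral_Ioi_one_inv hk, add_assoc, hlow, add_comm,
    ← lintegral_union measurableSet_Ioi (disjoint_left.2 fun x hx hx' ↦ not_lt.2 hx.2 hx'),
    Ioc_union_Ioi_eq_Ioi zero_le_one]

theorem hellinger_add_eq_lintegral_resolventTrace {k : ℕ} (hk : 2 ≤ k) (ρ σ : QState n) :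
    hellinger k ρ σ + ENNReal.ofReal (1 / ((k : ℝ) - 1)) =
      ∫⁻ s in Ioi (0 : ℝ), ENNReal.ofReal (resolventTrace k ρ σ s).re := by
  rw [hellinger_add_eq_lintegral_hockeyStick hk,
    lintegral_hockeyStick_eq_lintegral_resolventTrace ρ σ hk]

theorem integrableOn_resolventTrace {k : ℕ} (hk : 2 ≤ k) (ρ σ : QState n) (h : ρ.SuppLE σ) :
    IntegrableOn (fun s : ℝ ↦ (resolventTrace k ρ σ s).re) (Ioi 0) := by
  have hfin := lintegral_hockeyStick_ne_top ρ σ h k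
  rw [lintegral_hockeyStick_eq_lintegral_resolventTrace ρ σ hk] at hfin
  refine (lintegral_ofReal_ne_top_iff_integrable ?_ ?_).1 hfin
  -- Measurability in `s` comes from Tonelli: on `s > 0` the trace is a parametric integral of the
  -- count.
  · have hm : Measurable fun u : ℝ ↦ (∫⁻ γ in Ioi (0 : ℝ),
        ENNReal.ofReal (k * γ ^ (k - 1)) * (pencilCount ρ σ γ u : ℝ≥0∞)).toReal :=
      (measurable_weighted_pencilCount ρ σ k).lintegral_prod_left'.ennreal_toReal
    refine hm.aestronglyMeasurable.congr ?_
    filter_upwards [ae_restrict_mem measurableSet_Ioi] with u hu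
    rw [lintegral_pencilCount ρ σ hu (by omega), ENNReal.toReal_ofReal]
    exact (resolventTrace_im_eq_zero_and_re_nonneg k ρ σ hu).2
  · filter_upwards [ae_restrict_mem measurableSet_Ioi] with u hu
    exact (resolventTrace_im_eq_zero_and_re_nonneg k ρ σ hu).2

end

/-! ### Extended-real form and conclusion -/

theorem EReal.coe_eq_coe_sub_of_add_ofReal_eq {H I : ℝ≥0∞} {r : ℝ} (hr : 0 ≤ r)
    (h : H + ENNReal.ofReal r = I) : (H : EReal) = (I : EReal) - (r : EReal) := by
  rw [← h, EReal.coe_ennreal_add, EReal.coe_ennreal_ofReal, max_eq_left hr,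
    EReal.add_sub_cancel_right]

end
theorem theorem3p2 {n : Type*} [Fintype n] [DecidableEq n] (ρ σ : QState n)
    (α : ℕ) (hα : 2 ≤ α) :
    -- the integrand is real and nonnegative, so that its integral exists in `[0, ∞]`
    (∀ s : ℝ, 0 < s → (resolventTrace α ρ σ s).im = 0 ∧ 0 ≤ (resolventTrace α ρ σ s).re) ∧
    -- the two identities for arbitrary states, in the extended reals
    ((hellinger (α : ℝ) ρ σ : ℝ≥0∞) : EReal) =
      ((∫⁻ s in Ioi (0 : ℝ), ENNReal.ofReal (resolventTrace α ρ σ s).re : ℝ≥0∞) : EReal)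
        - ((1 / ((α : ℝ) - 1) : ℝ) : EReal) ∧
    renyi (α : ℝ) ρ σ =
      ((1 / ((α : ℝ) - 1) : ℝ) : EReal) *
        ENNReal.log (ENNReal.ofReal ((α : ℝ) - 1) *
          ∫⁻ s in Ioi (0 : ℝ), ENNReal.ofReal (resolventTrace α ρ σ s).re) ∧
    -- if `ρ ≪ σ`, everything is finite and the identities hold between real numbers
    (ρ.SuppLE σ →
      IntegrableOn (fun s : ℝ => (resolventTrace α ρ σ s).re) (Ioi 0) ∧
      ((hellinger (α : ℝ) ρ σ : ℝ≥0∞) : EReal) =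
        (((∫ s in Ioi (0 : ℝ), (resolventTrace α ρ σ s).re) - 1 / ((α : ℝ) - 1) : ℝ) : EReal) ∧
      renyi (α : ℝ) ρ σ =
        ((1 / ((α : ℝ) - 1) *
          Real.log (((α : ℝ) - 1) * ∫ s in Ioi (0 : ℝ), (resolventTrace α ρ σ s).re) : ℝ) :
            EReal)) := by
  have hα' : (2 : ℝ) ≤ α := by exact_mod_cast hα
  have hc : (0 : ℝ) < α - 1 := by linarith
  have hr : (0 : ℝ) < 1 / ((α : ℝ) - 1) := by positivity
  have hadd := hellinger_add_eq_lintegral_resolventTrace hα ρ σ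
  have hH := EReal.coe_eq_coe_sub_of_add_ofReal_eq hr.le hadd
  have hD : renyi (α : ℝ) ρ σ =
      ((1 / ((α : ℝ) - 1) : ℝ) : EReal) *
        ENNReal.log (ENNReal.ofReal ((α : ℝ) - 1) *
          ∫⁻ s in Ioi (0 : ℝ), ENNReal.ofReal (resolventTrace α ρ σ s).re) := by
    have h1 : (((α : ℝ) - 1 : ℝ) : EReal) = ((ENNReal.ofReal ((α : ℝ) - 1) : ℝ≥0∞) : EReal) := by
      rw [EReal.coe_ennreal_ofReal, max_eq_left hc.le]
    rw [renyi, h1, ← EReal.coe_ennreal_one, ← EReal.coe_ennreal_mul, ← EReal.coe_ennreal_add,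
      EReal.toENNReal_coe, ← hadd, mul_add, ← ENNReal.ofReal_mul hc.le, mul_one_div_cancel hc.ne',
      ENNReal.ofReal_one, add_comm]
  refine ⟨fun s hs ↦ resolventTrace_im_eq_zero_and_re_nonneg α ρ σ hs, hH, hD, fun hsupp ↦ ?_⟩
  have hint := integrableOn_resolventTrace hα ρ σ hsupp
  have hnonneg : 0 ≤ᵐ[volume.restrict (Ioi 0)] fun s : ℝ ↦ (resolventTrace α ρ σ s).re := by
    filter_upwards [ae_restrict_mem measurableSet_Ioi] with s hs
    exact (resolventTrace_im_eq_zero_and_re_nonneg α ρ σ hs).2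
  have hI := ofReal_integral_eq_lintegral_ofReal hint hnonneg
  have hJ0 : 0 ≤ ∫ s in Ioi (0 : ℝ), (resolventTrace α ρ σ s).re := integral_nonneg_of_ae hnonneg
  -- The integral is at least `1/(α-1)` because the divergence is nonnegative, so the logarithm has
  -- a positive argument.
  have hJ : 0 < ∫ s in Ioi (0 : ℝ), (resolventTrace α ρ σ s).re := by
    rw [← ENNReal.ofReal_pos, hI, ← hadd]
    exact (ENNReal.ofReal_pos.2 hr).trans_le le_add_self
  refine ⟨hint, ?_, ?_⟩
  · rw [hH, ← hI, EReal.coe_ennreal_ofReal, max_eq_left hJ0, ← EReal.coe_sub]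
  · rw [hD, ← hI, ← ENNReal.ofReal_mul hc.le, ENNReal.log_ofReal_of_pos (by positivity),
      ← EReal.coe_mul]
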